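/- Let $A$ be a partially ordered set of letters with an order-preserving involution $a\mapsto\bar a$, let $A^*$ be the set of words over $A$ with the Higman (subword) ordering ($a_0\cdots a_{n-1}\le b_0\cdots b_{m-1}$ iff there is a strictly increasing $h:\{0,\dots,n-1\}\to\{0,\dots,m-1\}$ with $a_i\le b_{h(i)}$ for all $i$), and put $\overline{a_0\cdots a_{n-1}}=\bar a_{n-1}\cdots\bar a_0$. Let $\mathbf F(A^*)$ be the set of final segments of $A^*$, ordered by reverse inclusion ($X\le Y$ iff $X\supseteq Y$), with the concatenation $X\cdot Y=\{\alpha\beta:\alpha\in X,\beta\in Y\}$, the least element $1=A^*$ and the involution $\overline X=\{\bar\alpha:\alpha\in X\}$. A metric space over $\mathbf F(A^*)$ is a set $E$ with a map $d:E\times E\to\mathbf F(A^*)$ such that, for all $x,y,z\in E$, $d(x,y)=1$ iff $x=y$, $d(x,y)\le d(x,z)\cdot d(z,y)$, and $d(x,y)=\overline{d(y,x)}$. A contraction $f:E\to E'$ is a map with $d'(f(x),f(y))\le d(x,y)$ for all $x,y$; it is an isometry if equality always holds. Products of metric spaces carry the supremum distance. $E$ is a retract of $E'$ if there are contractions $f:E\to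 E'$ and $g:E'\to E$ with $g\circ f=\mathrm{id}_E$; $E$ is an absolute retract if every isometry $f$ from $E$ into a metric space $E'$ over $\mathbf F(A^*)$ admits a contraction $g:E'\to E$ with $g\circ f=\mathrm{id}_E$. $E$ is finitely indecomposable if, for every finite family $(E_i)_{i\in I}$ of metric spaces over $\mathbf F(A^*)$ such that $E$ is a retract of $\prod_{i\in I}E_i$, the space $E$ is a retract of $E_i$ for some $i\in I$. $E$ is linearly orderable if there is a linear ordering $\preceq$ of $E$ such that $d(x,z)\le d(x,y)$ and $d(z,y)\le d(x,y)$ whenever $x\preceq z\preceq y$. Every finite, finitely indecomposable absolute retract over $\mathbf F(A^*)$ is linearly orderable. -/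

import Mathlib

universe u v w

namespace WordMetric

/-- An ordered alphabet: a partially ordered set of letters equipped with an order preserving
involution. -/
class InvolutiveAlphabet (A : Type u) extends PartialOrder A where
  bar : A → A
  bar_bar : ∀ a, bar (bar a) = a
  bar_mono : ∀ a b, a ≤ b → bar a ≤ bar b

/-- Words over the alphabet `A`. This wraps `List A`, so that the order below does not clash with
the lexicographic order of lists. -/
@[ext]
structure Word (A : Type u) where
  letters : List A

section
variable {A : Type u} [InvolutiveAlphabet A]

/-- The Higman (subword) ordering: `α ≤ β` if `α` is dominated, letter by letter, by some
subsequence of `β`. -/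
instance : LE (Word A) :=
  ⟨fun α β => List.SublistForall₂ (fun a b : A => a ≤ b) α.letters β.letters⟩

/-- Concatenation of words. -/
def Word.append (α β : Word A) : Word A := ⟨α.letters ++ β.letters⟩

/-- The involution on words: bar every letter and reverse the word. -/
def Word.bar (α : Word A) : Word A := ⟨(α.letters.map InvolutiveAlphabet.bar).reverse⟩

theorem Word.bar_bar (α : Word A) : α.bar.bar = α := by
  have h : (InvolutiveAlphabet.bar ∘ InvolutiveAlphabet.bar : A → A) = id :=
    funext InvolutiveAlphabet.bar_bar
  ext1
  simp [Word.bar, List.map_reverse, h]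

theorem Word.bar_mono {α β : Word A} (h : α ≤ β) : α.bar ≤ β.bar := by
  obtain ⟨l, h1, h2⟩ := List.sublistForall₂_iff.1 h
  refine List.sublistForall₂_iff.2
    ⟨(List.map InvolutiveAlphabet.bar l).reverse, ?_, (h2.map _).reverse⟩
  simp only [Word.bar]
  rw [List.forall₂_reverse_iff, List.forall₂_map_left_iff, List.forall₂_map_right_iff]
  exact h1.imp fun a b hab => InvolutiveAlphabet.bar_mono a b hab

theorem Word.exists_of_append_le {α β γ : Word A} (h : α.append β ≤ γ) :
    ∃ α' β' : Word A, α ≤ α' ∧ β ≤ β' ∧ γ = α'.append β' := by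
  obtain ⟨l, h1, h2⟩ := List.sublistForall₂_iff.1 h
  simp only [Word.append] at h1
  have h3 := (List.forall₂_take_append l α.letters β.letters h1.flip).flip
  have h4 := (List.forall₂_drop_append l α.letters β.letters h1.flip).flip
  rw [← List.take_append_drop α.letters.length l] at h2
  obtain ⟨r₁, r₂, e, h5, h6⟩ := List.append_sublist_iff.1 h2
  refine ⟨⟨r₁⟩, ⟨r₂⟩, List.sublistForall₂_iff.2 ⟨_, h3, h5⟩,
    List.sublistForall₂_iff.2 ⟨_, h4, h6⟩, ?_⟩
  ext1
  exact e

end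

/-- The set `F(A*)` of final segments of the set of words over `A` with the Higman ordering.
Mathlib orders upper sets by reverse inclusion, so that `⊥` is the set of all words (the neutral
element of the concatenation), joins are intersections and meets are unions. -/
abbrev FinalSegment (A : Type u) [InvolutiveAlphabet A] : Type u := UpperSet (Word A)

section
variable {A : Type u} [InvolutiveAlphabet A]

/-- The concatenation `X · Y = {αβ : α ∈ X, β ∈ Y}` of two final segments. -/
def FinalSegment.concat (X Y : FinalSegment A) : FinalSegment A where
  carrier := {γ | ∃ α ∈ X, ∃ β ∈ Y, γ = α.append β}
  upper' := by
    rintro _ δ h ⟨α, hα, β, hβ, rfl⟩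
    obtain ⟨α', β', h1, h2, rfl⟩ := Word.exists_of_append_le h
    exact ⟨α', X.upper h1 hα, β', Y.upper h2 hβ, rfl⟩

/-- The involution `X ↦ {ᾱ : α ∈ X}` on final segments. -/
def FinalSegment.bar (X : FinalSegment A) : FinalSegment A where
  carrier := {γ | ∃ α ∈ X, γ = α.bar}
  upper' := by
    rintro _ δ h ⟨α, hα, rfl⟩
    refine ⟨δ.bar, X.upper ?_ hα, (Word.bar_bar δ).symm⟩
    have := Word.bar_mono h
    rwa [Word.bar_bar] at this

theorem FinalSegment.mem_bar {X : FinalSegment A} {γ : Word A} : γ ∈ X.bar ↔ γ.bar ∈ X := by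
  constructor
  · rintro ⟨α, hα, rfl⟩
    rwa [Word.bar_bar]
  · intro h
    exact ⟨γ.bar, h, (Word.bar_bar γ).symm⟩

end

/-- A distance on the set `E` with values in `F(A*)`, i.e. the structure of a metric space
over `F(A*)`. -/
structure Metric (A : Type u) [InvolutiveAlphabet A] (E : Type v) where
  dist : E → E → FinalSegment A
  dist_eq_one_iff : ∀ x y, dist x y = ⊥ ↔ x = y
  triangle : ∀ x y z, dist x y ≤ (dist x z).concat (dist z y)
  dist_bar : ∀ x y, dist x y = (dist y x).bar

namespace Metric
variable {A : Type u} [InvolutiveAlphabet A]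

/-- Contractions, also called non-expansive maps. -/
def IsContraction {E : Type v} {E' : Type w} (d : Metric A E) (d' : Metric A E')
    (f : E → E') : Prop :=
  ∀ x y, d'.dist (f x) (f y) ≤ d.dist x y

/-- Distance preserving maps; an isometric extension of `E` is the target of such a map. -/
def IsIsometry {E : Type v} {E' : Type w} (d : Metric A E) (d' : Metric A E')
    (f : E → E') : Prop :=
  ∀ x y, d'.dist (f x) (f y) = d.dist x y

/-- The direct product of a family of metric spaces, with the supremum distance. -/
def pi {ι : Type w} {E : ι → Type v} (d : ∀ i, Metric A (E i)) : Metric A (∀ i, E i) where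
  dist x y := ⨆ i, (d i).dist (x i) (y i)
  dist_eq_one_iff x y := by
    rw [iSup_eq_bot, funext_iff]
    exact forall_congr' fun i => (d i).dist_eq_one_iff _ _
  triangle x y z := by
    refine iSup_le fun i => ((d i).triangle (x i) (y i) (z i)).trans ?_
    rintro _ ⟨α, hα, β, hβ, rfl⟩
    exact ⟨α, le_iSup (fun i => (d i).dist (x i) (z i)) i hα,
      β, le_iSup (fun i => (d i).dist (z i) (y i)) i hβ, rfl⟩
  dist_bar x y := by
    ext γ
    simp only [SetLike.mem_coe, FinalSegment.mem_bar, UpperSet.mem_iSup_iff]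
    refine forall_congr' fun i => ?_
    rw [(d i).dist_bar (x i) (y i), FinalSegment.mem_bar]

/-- `E` is a retract of `E'`. -/
def IsRetract {E : Type v} {E' : Type w} (d : Metric A E) (d' : Metric A E') : Prop :=
  ∃ (f : E → E') (g : E' → E), d.IsContraction d' f ∧ d'.IsContraction d g ∧ ∀ x, g (f x) = x

/-- `E` is an absolute retract: it is a retract of each of its isometric extensions, that is,
every isometry `f` from `E` to a metric space `E'` admits a contraction `g : E' → E` which is
the identity on `E`. -/
def IsAbsoluteRetract {E : Type v} (d : Metric A E) : Prop :=
  ∀ (E' : Type v) (d' : Metric A E') (f : E → E'), d.IsIsometry d' f →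
    ∃ g : E' → E, d'.IsContraction d g ∧ ∀ x, g (f x) = x

/-- `E` is finitely indecomposable: if it is a retract of the product of a finite family of
metric spaces, then it is a retract of a member of the family. -/
def IsFinitelyIndecomposable {E : Type v} (d : Metric A E) : Prop :=
  ∀ (ι : Type v) [Finite ι] (F : ι → Type v) (δ : ∀ i, Metric A (F i)),
    d.IsRetract (pi δ) → ∃ i, d.IsRetract (δ i)

/-- `E` is linearly orderable: for some linear ordering of `E`, the distances between `z` and the
ends of an interval containing `z` are at most the distance between these ends. -/
def IsLinearlyOrderable {E : Type v} (d : Metric A E) : Prop :=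
  ∃ _ : LinearOrder E, ∀ x y z : E, x ≤ z → z ≤ y →
    d.dist x z ≤ d.dist x y ∧ d.dist z y ≤ d.dist x y

end Metric

end WordMetric

namespace WordMetric

variable {A : Type u} [InvolutiveAlphabet A]

namespace Word

/-! For a point `x` and a word `w`, send `z` to the number of letters of the shortest prefix of `w`
lying in the distance from `x` to `z`, capped at one more than the length of `w`. This `rank` is a
contraction into `ofWord w`, a metric on `ℕ` compatible with the usual order (`isContraction_rank`),
and if `w` is not in the distance from `x` to `y`, it is not in that of their ranks
(`notMem_ofWord_rank`). So the rank functions embed `E` isometrically in a product, infinite in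
general. Grouping them by the preorder they induce on `E` makes the product finite, since a finite
`E` carries finitely many relations. Within a group all coordinates order points alike, so the image
of `E` is linearly orderable. The absolute retract `E` is a retract of this product, hence of one
factor, and inherits its order. -/

theorem le_of_sublist {α β : Word A} (h : α.letters.Sublist β.letters) : α ≤ β :=
  List.sublistForall₂_iff.2 ⟨α.letters, List.forall₂_refl _, h⟩

theorem le_trans' {α β γ : Word A} (h : α ≤ β) (h' : β ≤ γ) : α ≤ γ :=
  _root_.trans (r := List.SublistForall₂ (fun a b : A => a ≤ b)) h h'

theorem append_le_append_left (α : Word A) {β γ : Word A} (h : β ≤ γ) :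
    α.append β ≤ α.append γ := by
  obtain ⟨l, h1, h2⟩ := List.sublistForall₂_iff.1 h
  exact List.sublistForall₂_iff.2
    ⟨α.letters ++ l, List.rel_append (List.forall₂_refl _) h1, h2.append_left _⟩

theorem bar_append (α β : Word A) : (α.append β).bar = β.bar.append α.bar := by
  ext1
  simp [Word.bar, Word.append]

/-- The prefix of `w` with `i` letters. -/
def take (w : Word A) (i : ℕ) : Word A := ⟨w.letters.take i⟩

/-- The factor of `w` formed by the letters at the positions `i, …, j - 2`. -/
def segment (w : Word A) (i j : ℕ) : Word A := ⟨(w.letters.take (j - 1)).drop i⟩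

theorem segment_mono (w : Word A) {i i' j j' : ℕ} (hi : i ≤ i') (hj : j' ≤ j) :
    w.segment i' j' ≤ w.segment i j :=
  le_of_sublist <| (List.drop_sublist_drop_left _ hi).trans <|
    (List.take_sublist_take_left (by omega)).drop _

theorem take_append_segment {A : Type u} (w : Word A) {i j : ℕ} (h : i < j) :
    (w.take i).append (w.segment i j) = w.take (j - 1) := by
  have : w.letters.take i = (w.letters.take (j - 1)).take i := by
    rw [List.take_take, min_eq_left (by omega)]
  ext1
  simp only [Word.append, take, segment, this, List.take_append_drop]

/-- A factor that dominates `αβ` and ends before position `j - 1` can be cut at `k`: either its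
part before position `k - 1` dominates `α`, or its part from position `k` on dominates `β`. -/
theorem le_segment_or_le_segment (w : Word A) {α β : Word A} {i j : ℕ} (k : ℕ) (hij : i < j)
    (h : α.append β ≤ w.segment i j) :
    (i < k ∧ α ≤ w.segment i k) ∨ (k < j ∧ β ≤ w.segment k j) := by
  obtain ⟨α', β', hα, hβ, e⟩ := exists_of_append_le h
  have e' : (w.letters.take (j - 1)).drop i = α'.letters ++ β'.letters := congrArg letters e
  have hlen := congrArg List.length e'
  simp only [List.length_drop, List.length_take, List.length_append] at hlen
  -- Cutting at `k` loses the letter at position `k - 1`, which cannot lie in both `α'` and `β'`;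
  -- the part that avoids it survives whole.
  rcases lt_or_ge (i + α'.letters.length) k with hk | hk
  · refine Or.inl ⟨by omega, le_trans' hα (le_of_sublist ?_)⟩
    have h1 : α'.letters = ((w.letters.take (j - 1)).drop i).take α'.letters.length := by
      rw [e', List.take_left]
    rw [h1, List.take_drop, List.take_take]
    exact (List.take_sublist_take_left (by omega)).drop _
  · refine Or.inr ⟨by omega, le_trans' hβ (le_of_sublist ?_)⟩
    have h1 : β'.letters = ((w.letters.take (j - 1)).drop i).drop α'.letters.length := by
      rw [e', List.drop_left]
    rw [h1, List.drop_drop]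
    exact List.drop_sublist_drop_left _ hk

end Word

namespace Metric

/-- The distance on `ℕ` attached to a word `w`: for `i < j`, the distance from `i` to `j` consists
of the words that are not dominated by the factor of `w` between `i` and `j`. -/
def ofWord (w : Word A) : Metric A ℕ where
  dist i j :=
    { carrier := {α | (i < j → ¬ α ≤ w.segment i j) ∧ (j < i → ¬ α.bar ≤ w.segment j i)}
      upper' := fun _ _ h hα => ⟨fun hij h' => hα.1 hij (Word.le_trans' h h'),
        fun hij h' => hα.2 hij (Word.le_trans' (Word.bar_mono h) h')⟩ }
  dist_eq_one_iff i j := by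
    constructor
    · intro h
      -- The empty word is dominated by every factor, so it lies in no distance between distinct
      -- integers.
      have h0 : (⟨[]⟩ : Word A) ∈ (⊥ : FinalSegment A) := UpperSet.mem_bot
      rw [← h] at h0
      by_contra hij
      rcases lt_or_gt_of_ne hij with hij | hij
      · exact h0.1 hij (Word.le_of_sublist (List.nil_sublist _))
      · exact h0.2 hij (Word.le_of_sublist (List.nil_sublist _))
    · rintro rfl
      exact eq_bot_iff.2 fun α _ => ⟨fun h => (lt_irrefl _ h).elim, fun h => (lt_irrefl _ h).elim⟩
  triangle i j k := by
    rintro _ ⟨α, hα, β, hβ, rfl⟩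
    refine ⟨fun hij h => ?_, fun hij h => ?_⟩
    · rcases w.le_segment_or_le_segment k hij h with ⟨h1, h2⟩ | ⟨h1, h2⟩
      exacts [hα.1 h1 h2, hβ.1 h1 h2]
    · rw [Word.bar_append] at h
      rcases w.le_segment_or_le_segment k hij h with ⟨h1, h2⟩ | ⟨h1, h2⟩
      exacts [hβ.2 h1 h2, hα.2 h1 h2]
  dist_bar i j := by
    ext α
    rw [SetLike.mem_coe, SetLike.mem_coe, FinalSegment.mem_bar]
    change _ ∧ _ ↔ _ ∧ _
    rw [Word.bar_bar, and_comm]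

theorem ofWord_dist_le (w : Word A) {i j k l : ℕ} (hi : i ≤ k) (hkl : k ≤ l) (hj : l ≤ j) :
    (ofWord w).dist k l ≤ (ofWord w).dist i j := by
  intro α hα
  refine ⟨fun h h' => hα.1 (by omega) (Word.le_trans' h' (w.segment_mono hi hj)), fun h => ?_⟩
  omega

/-- The metric induced by an injective map. -/
def comap {E : Type v} {E' : Type w} (f : E → E') (hf : Function.Injective f)
    (d : Metric A E') : Metric A E where
  dist x y := d.dist (f x) (f y)
  dist_eq_one_iff _ _ := (d.dist_eq_one_iff _ _).trans hf.eq_iff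
  triangle _ _ _ := d.triangle _ _ _
  dist_bar _ _ := d.dist_bar _ _

section
variable {E : Type v} (d : Metric A E)

/-- The length of the least prefix of `w` in the distance from `x` to `z`, or the length of `w`
plus one if there is none. -/
noncomputable def rank (x : E) (w : Word A) (z : E) : ℕ :=
  sInf {i | w.take i ∈ d.dist x z ∨ i = w.letters.length + 1}

theorem rank_mem (x : E) (w : Word A) (z : E) :
    w.take (d.rank x w z) ∈ d.dist x z ∨ d.rank x w z = w.letters.length + 1 :=
  Nat.sInf_mem (s := {i | w.take i ∈ d.dist x z ∨ i = w.letters.length + 1}) ⟨_, Or.inr rfl⟩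

theorem rank_le_length_add_one (x : E) (w : Word A) (z : E) :
    d.rank x w z ≤ w.letters.length + 1 :=
  Nat.sInf_le (Or.inr rfl)

theorem rank_le_of_take_mem {x z : E} {w : Word A} {i : ℕ} (h : w.take i ∈ d.dist x z) :
    d.rank x w z ≤ i :=
  Nat.sInf_le (Or.inl h)

theorem rank_self (x : E) (w : Word A) : d.rank x w x = 0 := by
  refine Nat.le_zero.1 (d.rank_le_of_take_mem ?_)
  rw [(d.dist_eq_one_iff x x).2 rfl]
  exact UpperSet.mem_bot

theorem rank_eq_length_add_one {x y : E} {w : Word A} (h : w ∉ d.dist x y) :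
    d.rank x w y = w.letters.length + 1 :=
  (d.rank_mem x w y).resolve_left fun h' =>
    h ((d.dist x y).upper (Word.le_of_sublist (List.take_sublist _ _)) h')

/-- Otherwise the triangle inequality through `y` would put the prefix of `w` that stops one letter
short of the rank of `z` into the distance from `x` to `z`, against minimality. This is why
`segment` stops at `j - 2`. -/
theorem not_le_segment_rank (x : E) (w : Word A) {y z : E} {α : Word A}
    (hα : α ∈ d.dist y z) (hlt : d.rank x w y < d.rank x w z) :
    ¬ α ≤ w.segment (d.rank x w y) (d.rank x w z) := by
  intro h
  -- The rank of `y` is not the default value, being smaller than another rank.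
  have hy : w.take (d.rank x w y) ∈ d.dist x y := by
    refine (d.rank_mem x w y).resolve_right ?_
    have := d.rank_le_length_add_one x w z
    omega
  have hz : (w.take (d.rank x w y)).append α ∈ d.dist x z := d.triangle x z y ⟨_, hy, _, hα, rfl⟩
  have := (d.dist x z).upper (Word.append_le_append_left _ h) hz
  rw [Word.take_append_segment w hlt] at this
  have := d.rank_le_of_take_mem this
  omega

theorem isContraction_rank (x : E) (w : Word A) : d.IsContraction (ofWord w) (d.rank x w) := by
  intro y z α hα
  refine ⟨fun h => d.not_le_segment_rank x w hα h, fun h => d.not_le_segment_rank x w ?_ h⟩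
  have hα' : α ∈ d.dist y z := hα
  rwa [d.dist_bar, FinalSegment.mem_bar] at hα'

theorem notMem_ofWord_rank {x y : E} {w : Word A} (h : w ∉ d.dist x y) :
    w ∉ (ofWord w).dist (d.rank x w x) (d.rank x w y) := by
  rw [rank_self, d.rank_eq_length_add_one h]
  intro hw
  -- The factor between `0` and the length of `w` plus one is `w` itself.
  refine hw.1 (Nat.succ_pos _) (Word.le_of_sublist ?_)
  simp [Word.segment]

end

section
variable {E : Type u} (d : Metric A E) (p : E → E → Prop)

/-- The pairs of a point and a word whose rank function induces the total preorder `p`. -/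
def RankIndex : Type u :=
  {s : E × Word A // ∀ y z, d.rank s.1 s.2 y ≤ d.rank s.1 s.2 z ↔ p y z}

/-- The map whose coordinates are the rank functions that induce the total preorder `p`. -/
noncomputable def rankMap (z : E) (s : d.RankIndex p) : ℕ := d.rank s.1.1 s.1.2 z

/-- The image of `E` under the rank functions that induce the total preorder `p`, as a subspace
of a product. -/
noncomputable def rankMetric : Metric A (Set.range (d.rankMap p)) :=
  comap Subtype.val Subtype.val_injective (pi fun s : d.RankIndex p => ofWord s.1.2)

theorem mem_rankMetric {a b : Set.range (d.rankMap p)} {α : Word A} :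
    α ∈ (d.rankMetric p).dist a b ↔ ∀ s, α ∈ (ofWord s.1.2).dist (a.1 s) (b.1 s) :=
  UpperSet.mem_iSup_iff

theorem rankMap_le_iff {a b : Set.range (d.rankMap p)} (s t : d.RankIndex p) :
    a.1 s ≤ b.1 s ↔ a.1 t ≤ b.1 t := by
  obtain ⟨_, y, rfl⟩ := a
  obtain ⟨_, z, rfl⟩ := b
  exact (s.2 y z).trans (t.2 y z).symm

theorem isLinearlyOrderable_rankMetric : (d.rankMetric p).IsLinearlyOrderable := by
  -- If no rank function induces `p`, the product is empty and the image has at most one point;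
  -- otherwise any single coordinate determines the order.
  rcases isEmpty_or_nonempty (d.RankIndex p) with hp | ⟨⟨s⟩⟩
  · have : Subsingleton (Set.range (d.rankMap p)) :=
      ⟨fun a b => Subtype.ext (funext fun s => hp.elim s)⟩
    refine ⟨LinearOrder.lift' (fun _ => 0) (Function.injective_of_subsingleton _),
      fun x y z _ _ => ?_⟩
    rw [Subsingleton.elim x z, Subsingleton.elim y z]
    exact ⟨le_rfl, le_rfl⟩
  · have hinj : Function.Injective fun a : Set.range (d.rankMap p) => a.1 s :=
      fun a b h => Subtype.ext <| funext fun t =>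
        le_antisymm ((d.rankMap_le_iff p s t).1 h.le) ((d.rankMap_le_iff p s t).1 h.ge)
    refine ⟨LinearOrder.lift' _ hinj, fun x y z hxz hzy => ?_⟩
    have hxz' (t) : x.1 t ≤ z.1 t := (d.rankMap_le_iff p s t).1 hxz
    have hzy' (t) : z.1 t ≤ y.1 t := (d.rankMap_le_iff p s t).1 hzy
    exact ⟨iSup_mono fun t => ofWord_dist_le _ le_rfl (hxz' t) (hzy' t),
      iSup_mono fun t => ofWord_dist_le _ (hxz' t) (hzy' t) le_rfl⟩

theorem isIsometry_rankMap : d.IsIsometry (pi d.rankMetric)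
    fun z p => (⟨d.rankMap p z, z, rfl⟩ : Set.range (d.rankMap p)) := by
  intro x y
  refine le_antisymm (iSup_le fun p => iSup_le fun s => d.isContraction_rank _ _ x y) ?_
  intro α hα
  by_contra h
  refine d.notMem_ofWord_rank h ?_
  -- The factor to look at is the one whose relation is induced by the rank function of `x` and `α`.
  have h1 := UpperSet.mem_iSup_iff.1 hα fun y z => d.rank x α y ≤ d.rank x α z
  exact (d.mem_rankMetric _).1 h1 ⟨(x, α), fun _ _ => Iff.rfl⟩

end

/-- The section of a retraction is an isometry, so the order pulls back along it. -/
theorem IsRetract.isLinearlyOrderable {E : Type v} {E' : Type w} {d : Metric A E}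
    {d' : Metric A E'} (h : d.IsRetract d') (h' : d'.IsLinearlyOrderable) :
    d.IsLinearlyOrderable := by
  obtain ⟨f, g, hf, hg, hgf⟩ := h
  obtain ⟨_, hlin⟩ := h'
  have hiso (x y : E) : d'.dist (f x) (f y) = d.dist x y :=
    le_antisymm (hf x y) (by simpa only [hgf] using hg (f x) (f y))
  refine ⟨LinearOrder.lift' f (Function.LeftInverse.injective hgf), fun x y z hxz hzy => ?_⟩
  simpa only [hiso] using hlin (f x) (f y) (f z) hxz hzy

theorem IsAbsoluteRetract.isRetract {E E' : Type v} {d : Metric A E} {d' : Metric A E'}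
    (h : d.IsAbsoluteRetract) {f : E → E'} (hf : d.IsIsometry d' f) : d.IsRetract d' := by
  obtain ⟨g, hg, hgf⟩ := h E' d' f hf
  exact ⟨f, g, fun x y => (hf x y).le, hg, hgf⟩

end Metric

end WordMetric

theorem mainTheorem11 {A : Type u} [WordMetric.InvolutiveAlphabet A] {E : Type u} [Finite E]
    (d : WordMetric.Metric A E) (hretract : d.IsAbsoluteRetract)
    (hindec : d.IsFinitelyIndecomposable) : d.IsLinearlyOrderable := by
  obtain ⟨p, hp⟩ := hindec (E → E → Prop) _ d.rankMetric
    (hretract.isRetract d.isIsometry_rankMap)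
  exact hp.isLinearlyOrderable (d.isLinearlyOrderable_rankMetric p)
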